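/- Let $P$ be a $2$-truncated cube, i.e. a combinatorial simple polytope obtained from the cube $I^n$ by a fixed finite sequence of $2$-truncations $I^n=P_0,P_1,\dots,P_m=P$: for each $k$, $P_k$ is obtained from $P_{k-1}$ by truncating a face $G_k$ of codimension $2$, which means that the simplicial complex $\partial P_k^*$ is the stellar subdivision of $\partial P_{k-1}^*$ along the simplex corresponding to $G_k$; the new vertex corresponds to the new facet $F_k\cong G_k\times I$ of $P_k$ (the section facet). Define, for every nonempty face $Q$ of $P$ (including $Q=P$), a simplicial complex $\Delta(Q)$ on the vertex set $\{w(F_1),\dots,w(F_m)\}$ recursively as follows. For $P_0=I^n$, $\Delta(Q)=\emptyset$ (no vertices, only the empty simplex) for all faces $Q$. Suppose $\Delta$ is defined on the faces of $P_{k-1}$, and let $\tilde Q$ be a nonempty face of $P_k$. (a) If $\tilde Q\not\subset F_k$, let $Q$ be the face of $P_{k-1}$ such that the facets of $P_{k-1}$ containing $Q$ are those corresponding to the facets of $P_k$ containing $\tilde Q$. If $G_k\cap Q$ is nonempty and of codimension $2$ in $Q$ (so that $\tilde Q$ is obtained from $Q$ by $2$-truncation of $G_k\cap Q$), put $\Delta(\tilde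 Q)=\Delta(Q)\cup\bigl(\Delta(G_k\cap Q)\star w(F_k)\bigr)$, where $\star$ denotes the join; otherwise put $\Delta(\tilde Q)=\Delta(Q)$. (b) If $\tilde Q\subset F_k\cong G_k\times I$, then $\tilde Q$ is $Q\times I$ or a copy $Q\times\{0\}$, $Q\times\{1\}$ of $Q$ for a unique face $Q\subset G_k$ of $P_{k-1}$, and $\Delta(\tilde Q)=\Delta(Q)$. Then the function $\Delta$ is monotone: if $Q_1\subset Q_2$ are nonempty faces of $P$, then $\Delta(Q_1)\subset\Delta(Q_2)$. -/

import Mathlib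

noncomputable section

open scoped Classical

namespace TwoTruncatedCube

/-- Stellar subdivision of `K` along the simplex `g` with new vertex `v`: the simplices containing
`g` are removed, and the cone with apex `v` over `∂g * link g` is glued in. -/
def stellar {V : Type*} [DecidableEq V] (K : PreAbstractSimplicialComplex V) (g : Finset V) (v : V) :
    PreAbstractSimplicialComplex V where
  faces := {σ | (σ ∈ K ∧ ¬ g ⊆ σ) ∨ ∃ τ : Finset V, ¬ g ⊆ τ ∧ τ ∪ g ∈ K ∧ σ = insert v τ}
  isRelLowerSet_faces := by
    rintro σ (⟨hσ, hg⟩ | ⟨τ, hg, hτ, rfl⟩)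
    · exact ⟨(K.isRelLowerSet_faces hσ).1, fun ρ hρ hne =>
        Or.inl ⟨(K.isRelLowerSet_faces hσ).2 hρ hne, fun h => hg (h.trans hρ)⟩⟩
    · refine ⟨Finset.insert_nonempty _ _, fun ρ hρ hne => ?_⟩
      by_cases hv : v ∈ ρ
      · refine Or.inr ⟨ρ ∩ τ, fun h => hg (h.trans Finset.inter_subset_right), ?_, ?_⟩
        · refine (K.isRelLowerSet_faces hτ).2
            (Finset.union_subset_union_left Finset.inter_subset_right) ?_
          have : g.Nonempty := by
            rw [Finset.nonempty_iff_ne_empty]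
            rintro rfl
            exact hg (Finset.empty_subset _)
          exact this.mono Finset.subset_union_right
        · ext x
          have := @hρ x
          simp only [Finset.mem_insert, Finset.mem_inter] at this ⊢
          constructor
          · intro hx
            rcases this hx with h | h
            · exact Or.inl h
            · exact Or.inr ⟨hx, h⟩
          · rintro (rfl | h)
            · exact hv
            · exact h.1
      · have hρτ : ρ ⊆ τ := (Finset.subset_insert_iff_of_notMem hv).1 hρ
        exact Or.inl ⟨(K.isRelLowerSet_faces hτ).2 (hρτ.trans Finset.subset_union_left) hne,
          fun h => hg (h.trans hρτ)⟩

/-- The cone (join with a point) `L ⋆ w`. The cone over the empty complex is the point `w`. -/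
def cone {V : Type*} [DecidableEq V] (L : PreAbstractSimplicialComplex V) (w : V) :
    PreAbstractSimplicialComplex V where
  faces := {σ | σ ∈ L ∨ ∃ τ : Finset V, (τ = ∅ ∨ τ ∈ L) ∧ σ = insert w τ}
  isRelLowerSet_faces := by
    rintro σ (hσ | ⟨τ, hτ, rfl⟩)
    · exact ⟨(L.isRelLowerSet_faces hσ).1, fun ρ hρ hne =>
        Or.inl ((L.isRelLowerSet_faces hσ).2 hρ hne)⟩
    · refine ⟨Finset.insert_nonempty _ _, fun ρ hρ hne => ?_⟩
      have key : ∀ α : Finset V, α ⊆ τ → α = ∅ ∨ α ∈ L := by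
        intro α hα
        rcases α.eq_empty_or_nonempty with h | h
        · exact Or.inl h
        · rcases hτ with rfl | hτ
          · exact Or.inl (Finset.subset_empty.1 hα)
          · exact Or.inr ((L.isRelLowerSet_faces hτ).2 hα h)
      by_cases hw : w ∈ ρ
      · exact Or.inr ⟨ρ.erase w, key _ (Finset.subset_insert_iff.1 hρ),
          (Finset.insert_erase hw).symm⟩
      · rcases key ρ ((Finset.subset_insert_iff_of_notMem hw).1 hρ) with h | h
        · exact absurd h hne.ne_empty
        · exact Or.inl h

/-- Names of the facets of an iterated truncation of the cube `I^n`: `Sum.inl (i, ε)` is the facet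
coming from the facet `x_i = ε` of the cube, and `Sum.inr k` is the section facet that
arises in the truncation number `k` (counted from `0`). -/
abbrev Facet (n : ℕ) : Type := (Fin n × Bool) ⊕ ℕ

/-- The boundary complex `∂(I^n)^*` of the polytope dual to the cube (the cross-polytope): a
nonempty set of facets of the cube is a simplex iff it contains no two opposite facets. -/
def cubeComplex (n : ℕ) : PreAbstractSimplicialComplex (Facet n) where
  faces := {σ | σ.Nonempty ∧ (∀ k : ℕ, Sum.inr k ∉ σ) ∧
    ∀ i : Fin n, ¬ (Sum.inl (i, false) ∈ σ ∧ Sum.inl (i, true) ∈ σ)}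
  isRelLowerSet_faces := by
    rintro σ ⟨hne, h1, h2⟩
    exact ⟨hne, fun ρ hρ hne' => ⟨hne', fun k hk => h1 k (hρ hk),
      fun i hi => h2 i ⟨hρ hi.1, hρ hi.2⟩⟩⟩

/-- A combinatorial simple polytope `P` is given by the complex `K = ∂P^*` on its set of facets.
A nonempty face `Q` of `P` (with `Q = P` allowed) is given by the set `σ_Q` of the facets that
contain it: it is empty for `Q = P` and a simplex of `K` otherwise. The codimension of `Q` is the
cardinality of `σ_Q`. -/
@[ext]
structure Face {V : Type*} (K : PreAbstractSimplicialComplex V) where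
  facets : Finset V
  mem : facets = ∅ ∨ facets ∈ K

/-- Inclusion of faces: `Q₁ ⊆ Q₂` iff every facet containing `Q₂` contains `Q₁`. -/
instance {V : Type*} (K : PreAbstractSimplicialComplex V) : PartialOrder (Face K) where
  le Q₁ Q₂ := Q₂.facets ⊆ Q₁.facets
  le_refl _ := Finset.Subset.refl _
  le_trans _ _ _ h₁ h₂ := Finset.Subset.trans h₂ h₁
  le_antisymm _ _ h₁ h₂ := Face.ext (Finset.Subset.antisymm h₂ h₁)

/-- `TruncationSequence n m K`: sequences of `m` successive 2-truncations that start with the cube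
`I^n` and end with the 2-truncated cube `P` with `∂P^* = K`. Each step truncates a face `G` of
codimension 2, given by the set of the two facets containing it; the truncation is the stellar
subdivision along the simplex `G`, and its new vertex is the new section facet. -/
inductive TruncationSequence (n : ℕ) : ℕ → PreAbstractSimplicialComplex (Facet n) → Type
  | cube : TruncationSequence n 0 (cubeComplex n)
  | truncate {m : ℕ} {K : PreAbstractSimplicialComplex (Facet n)}
      (T : TruncationSequence n m K) (G : Finset (Facet n)) (hG : G ∈ K) (hcodim : G.card = 2) :
      TruncationSequence n (m + 1) (stellar K G (Sum.inr m))

namespace TruncationSequence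

/-- The complex `Δ` of the face with set of facets `σ`; only the `σ` that belong to faces matter.
The vertex `w` of the section facet `Sum.inr k` is the number `k`.

In the step from `P` to its truncation along `G`, with section facet `F = Sum.inr m`, let `Q'` be
the face of the new polytope with set of facets `σ`.
* If `F ∈ σ`, then `Q'` lies in the section facet `G × I`, and `Q'` is `Q × I` or a copy `Q × {0}`,
  `Q × {1}` of `Q`, where `Q ⊆ G` is the face of `P` with set of facets `(σ \ {F}) ∪ G`.
* If `F ∉ σ`, then `σ` is also the set of facets of a face `Q` of `P`. If `G ∩ Q` is nonempty
  and has codimension 2 in `Q`, then `Q'` is the 2-truncation of `Q` along `G ∩ Q`; otherwise `Q'`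
  is the face `Q`, unchanged. -/
def deltaAux {n : ℕ} : {m : ℕ} → {K : PreAbstractSimplicialComplex (Facet n)} →
    TruncationSequence n m K → Finset (Facet n) → PreAbstractSimplicialComplex ℕ
  | _, _, cube, _ => ⊥
  | _, _, @truncate _ m K T G _ _, σ =>
    if Sum.inr m ∈ σ then T.deltaAux (σ.erase (Sum.inr m) ∪ G)
    else if σ ∪ G ∈ K ∧ (σ ∪ G).card = σ.card + 2 then
      T.deltaAux σ ⊔ cone (T.deltaAux (σ ∪ G)) m
    else T.deltaAux σ

/-- The simplicial complex `Δ(Q)` of a face `Q` of the 2-truncated cube obtained by `T`. -/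
def delta {n m : ℕ} {K : PreAbstractSimplicialComplex (Facet n)}
    (T : TruncationSequence n m K) (Q : Face K) : PreAbstractSimplicialComplex ℕ :=
  T.deltaAux Q.facets

end TruncationSequence

/-- A convex polytope: the convex hull of a finite set. -/
def IsConvexPolytope {d : ℕ} (P : Set (EuclideanSpace ℝ (Fin d))) : Prop :=
  ∃ s : Set (EuclideanSpace ℝ (Fin d)), s.Finite ∧ P = convexHull ℝ s

/-- The nonempty faces of a convex polytope `P` (including `P`), ordered by inclusion: the sets
where a linear functional attains its maximum on `P`. -/
abbrev GeometricFace {d : ℕ} (P : Set (EuclideanSpace ℝ (Fin d))) : Type :=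
  {Q : Set (EuclideanSpace ℝ (Fin d)) // Q.Nonempty ∧ IsExposed ℝ P Q}

end TwoTruncatedCube

end

namespace TwoTruncatedCube

/-! Passing to a larger face means passing to fewer facets, so monotonicity of Δ is antitonicity of
`deltaAux`, proved by induction on the truncations. The crux is that being cut in codimension 2 is
inherited by larger faces: if `G` cuts a face that way, it cuts every larger face outside the
section facet likewise. So whenever the smaller face acquires a cone, the larger one does too, and
the two are compared by `cone_mono`. In all other cases, the smaller face gets only an old complex,
and a truncation never shrinks Δ of a face outside the section facet. -/

theorem cone_mono {V : Type*} [DecidableEq V] {L M : PreAbstractSimplicialComplex V}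
    (h : L ≤ M) (w : V) : cone L w ≤ cone M w := by
  rintro σ (hσ | ⟨τ, hτ, rfl⟩)
  · exact Or.inl (h hσ)
  · exact Or.inr ⟨τ, hτ.imp_right fun hτ => h hτ, rfl⟩

/-- Antitonicity holds for arbitrary sets of facets, not only for those that belong to faces. -/
theorem TruncationSequence.deltaAux_antitone {n m : ℕ}
    {K : PreAbstractSimplicialComplex (Facet n)} (T : TruncationSequence n m K) :
    Antitone T.deltaAux := by
  induction T with
  | cube => exact fun _ _ _ => le_rfl
  | @truncate m K T G hG hcodim ih =>
    intro σ ρ hσρ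
    have hle : T.deltaAux σ ≤ (T.truncate G hG hcodim).deltaAux σ ∨ Sum.inr m ∈ σ := by
      by_cases h : Sum.inr m ∈ σ
      · exact Or.inr h
      · left
        simp only [deltaAux, if_neg h]
        split_ifs
        · exact le_sup_left
        · exact le_rfl
    by_cases hσ : Sum.inr m ∈ σ
    · simp only [deltaAux, if_pos hσ, if_pos (hσρ hσ)]
      -- Since `ih` covers arbitrary sets of facets, these unions need not be shown to be simplices
      -- of `K`.
      exact ih (Finset.union_subset_union_left (Finset.erase_subset_erase _ hσρ))
    replace hle := hle.resolve_right hσ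
    by_cases hρ : Sum.inr m ∈ ρ
    · refine le_trans ?_ hle
      simp only [deltaAux, if_pos hρ]
      -- The smaller face lies in the section facet, the larger does not: the face of `G` under the
      -- smaller one already lies in the larger one before the truncation.
      exact ih ((Finset.subset_erase.2 ⟨hσρ, hσ⟩).trans Finset.subset_union_left)
    by_cases hcut : ρ ∪ G ∈ K ∧ (ρ ∪ G).card = ρ.card + 2
    · have hmem : σ ∪ G ∈ K := (K.isRelLowerSet_faces hcut.1).2
        (Finset.union_subset_union_left hσρ)
        ((K.isRelLowerSet_faces hG).1.mono Finset.subset_union_right)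
      have hdisj : Disjoint ρ G := by
        rw [← Finset.card_union_eq_card_add_card, hcodim, hcut.2]
      have hcard : (σ ∪ G).card = σ.card + 2 := by
        rw [Finset.card_union_of_disjoint (hdisj.mono_left hσρ), hcodim]
      simp only [deltaAux, if_neg hσ, if_neg hρ, if_pos hcut,
        if_pos (show σ ∪ G ∈ K ∧ (σ ∪ G).card = σ.card + 2 from ⟨hmem, hcard⟩)]
      exact sup_le_sup (ih hσρ) (cone_mono (ih (Finset.union_subset_union_left hσρ)) m)
    · refine le_trans ?_ hle
      simp only [deltaAux, if_neg hρ, if_neg hcut]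
      exact ih hσρ

theorem TruncationSequence.delta_mono {n m : ℕ} {K : PreAbstractSimplicialComplex (Facet n)}
    (T : TruncationSequence n m K) : Monotone T.delta :=
  fun _ _ h => T.deltaAux_antitone h

end TwoTruncatedCube

/-- Let `T` be a sequence of 2-truncations that leads from the cube `I^n` to the 2-truncated cube
with dual boundary complex `K`. Then `Δ` is monotone on the faces of this combinatorial polytope,
and also on the faces of every convex polytope `P` that realizes it, that is, whose poset of nonempty
faces is identified by `φ` with the poset of faces of the combinatorial polytope. -/
theorem mainTheorem2 {n m : ℕ} {K : PreAbstractSimplicialComplex (TwoTruncatedCube.Facet n)}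
    (T : TwoTruncatedCube.TruncationSequence n m K) :
    (∀ Q₁ Q₂ : TwoTruncatedCube.Face K, Q₁ ≤ Q₂ → T.delta Q₁ ≤ T.delta Q₂) ∧
    (∀ (d : ℕ) (P : Set (EuclideanSpace ℝ (Fin d))), TwoTruncatedCube.IsConvexPolytope P →
      ∀ (φ : TwoTruncatedCube.GeometricFace P ≃o TwoTruncatedCube.Face K)
        (Q₁ Q₂ : TwoTruncatedCube.GeometricFace P),
        (Q₁ : Set (EuclideanSpace ℝ (Fin d))) ⊆ (Q₂ : Set (EuclideanSpace ℝ (Fin d))) →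
        T.delta (φ Q₁) ≤ T.delta (φ Q₂)) := by
  -- The order on geometric faces is inclusion, so only monotonicity of `φ` is needed.
  exact ⟨fun _ _ h => T.delta_mono h, fun _ _ _ φ _ _ h => T.delta_mono (φ.monotone h)⟩
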